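/- All graphs are finite, simple and have at least one vertex. Write $P_k$ and $C_k$ for the path and the cycle on $k$ vertices, and $2P_3$ for the disjoint union of two copies of $P_3$. A graph $G$ contains an induced $H$ if some induced subgraph of $G$ is isomorphic to $H$, and $G$ is $(2P_3,C_4,C_6)$-free if it contains none of $2P_3$, $C_4$, $C_6$ as an induced subgraph. A vertex is simplicial if its neighbors form a (possibly empty) clique. Let $T_0$ be the graph with the nine vertices $a_0,a_1,b_0,b_1,b_2,b_3,c_1,c_2,c_3$ and exactly the fourteen edges $a_0a_1$, $a_0b_0$, $a_0b_2$, $a_0b_3$, $a_1b_1$, $a_1b_2$, $a_1b_3$, $c_1c_2$, $c_1c_3$, $c_2c_3$, $c_1b_0$, $c_1b_1$, $c_2b_2$, $c_3b_3$. The clique-width $\mathrm{cwd}(G)$ of a graph $G$ is the minimum number of labels needed to construct $G$ using the following four operations: creation of a new vertex with label $i$; disjoint union of two labeled graphs; joining by an edge every vertex labeled $i$ to every vertex labeled $j$, where $i\neq j$; renaming label $i$ to label $j$. **Theorem.** Let $G$ be a $(2P_3,C_4,C_6)$-free graph that contains an induced $C_7$ or an induced $T_0$, and assume that $G$ contains no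 simplicial vertices. Then $\mathrm{cwd}(G)\leq 12$. -/

import Mathlib

open scoped SimpleGraph

/-- The graph `2P₃`: the disjoint union of two copies of the path on three vertices. -/
def twoP3 : SimpleGraph (Fin 3 ⊕ Fin 3) :=
  SimpleGraph.pathGraph 3 ⊕g SimpleGraph.pathGraph 3

/-- The vertices of the graph `T₀`. -/
inductive T0Vertex : Type
  | a0 | a1 | b0 | b1 | b2 | b3 | c1 | c2 | c3

open T0Vertex in
/-- The graph `T₀` (nine vertices, fourteen edges): `a₀a₁` is an edge; `b₀, b₁, b₂, b₃` is a stable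
set; `c₁, c₂, c₃` is a triangle; `a₀` is adjacent to `b₀, b₂, b₃`; `a₁` is adjacent to `b₁, b₂, b₃`;
`c₁` is adjacent to `b₀, b₁`; `c₂` is adjacent to `b₂`; `c₃` is adjacent to `b₃`; and there are no
other edges. -/
def graphT0 : SimpleGraph T0Vertex :=
  SimpleGraph.fromEdgeSet
    {s(a0, a1),
     s(a0, b0), s(a0, b2), s(a0, b3),
     s(a1, b1), s(a1, b2), s(a1, b3),
     s(c1, c2), s(c1, c3), s(c2, c3),
     s(c1, b0), s(c1, b1), s(c2, b2), s(c3, b3)}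

/-- A vertex is simplicial if its neighbours form a (possibly empty) clique. -/
def IsSimplicialVertex {V : Type*} (G : SimpleGraph V) (v : V) : Prop :=
  G.IsClique (G.neighborSet v)

/-- Construction sequences for labelled graphs with labels in `Fin k`, built from the four
clique-width operations. -/
inductive CWExpr (k : ℕ) : Type
  /-- creation of a new vertex with label `i` -/
  | vertex (i : Fin k) : CWExpr k
  /-- disjoint union of two labelled graphs -/
  | union (e f : CWExpr k) : CWExpr k
  /-- joining by an edge every vertex labelled `i` to every vertex labelled `j`, where `i ≠ j` -/
  | join (i j : Fin k) (hij : i ≠ j) (e : CWExpr k) : CWExpr k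
  /-- renaming label `i` to label `j` -/
  | rename (i j : Fin k) (e : CWExpr k) : CWExpr k

namespace CWExpr

/-- The vertex set of the graph constructed by an expression. -/
def Vert {k : ℕ} : CWExpr k → Type
  | vertex _ => Unit
  | union e f => e.Vert ⊕ f.Vert
  | join _ _ _ e => e.Vert
  | rename _ _ e => e.Vert

/-- The labels of the vertices at the end of the construction. -/
def label {k : ℕ} : (e : CWExpr k) → e.Vert → Fin k
  | vertex i => fun _ => i
  | union e f => Sum.elim e.label f.label
  | join _ _ _ e => e.label
  | rename i j e => fun x => if e.label x = i then j else e.label x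

/-- The graph constructed by an expression. -/
def graph {k : ℕ} : (e : CWExpr k) → SimpleGraph e.Vert
  | vertex _ => ⊥
  | union e f => e.graph ⊕g f.graph
  | join i j _ e => e.graph ⊔ SimpleGraph.fromRel fun x y => e.label x = i ∧ e.label y = j
  | rename _ _ e => e.graph

end CWExpr

/-- The graph `G` can be constructed, up to isomorphism, using the four operations with `k`
available labels. -/
def ConstructibleWithLabels {V : Type*} (G : SimpleGraph V) (k : ℕ) : Prop :=
  ∃ e : CWExpr k, Nonempty (e.graph ≃g G)

/-- The clique-width of `G`: the minimum number of labels with which `G` can be constructed. It is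
`⊤` if there is no such number, so a bound `cliqueWidth G ≤ k` with `k : ℕ` includes that `G` can be
constructed. -/
noncomputable def cliqueWidth {V : Type*} (G : SimpleGraph V) : ℕ∞ :=
  ⨅ (k : ℕ) (_ : ConstructibleWithLabels G k), (k : ℕ∞)

/-! ### Closed adjacency, forbidden tuples and simplicial vertices -/

namespace SimpleGraph

variable {V : Type*} {G : SimpleGraph V}

/-! Fix an induced copy of `C₇` or `T₀` and sort all vertices by type: the set of vertices of the
copy to which they are equal or adjacent. With closed adjacency the vertices of the copy are typed
like all others. Moreover `2P₃`, `C₄` and `C₆` have no true twins, so closed adjacency detects them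
without any distinctness conditions.

Forbidding these graphs in the copy extended by one or two vertices gives finite checks with four
consequences. Only few types survive. Closed adjacency is constant between two surviving nonempty
types and inside each (type `{c₂, c₃}` over `T₀`, which is eliminated below, aside), so the graph is
a blow-up of a small graph into cliques (`closedAdj_congr_of_typeCode`). Vertices of full type are
universal. Finally, the empty type, and over `T₀` also the type `{c₂, c₃}`, would contain a
simplicial vertex (`exists_isSimplicialVertex`), so they do not occur.

A blow-up into cliques needs one label per type, and universal vertices can be added at the end
without a label of their own (`constructibleWithLabels_of_closedAdj_congr`). Over `C₇` there are 7
types of cycle vertices, at most 2 types `{i, i + 1, i + 4}` and at most 3 types of five consecutive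
vertices, and 7 + 2 + 3 = 12. Over `T₀` exactly 12 codes remain, the full one included. -/

/-- Closed adjacency: equal or adjacent. -/
def ClosedAdj (G : SimpleGraph V) (x y : V) : Prop := x = y ∨ G.Adj x y

lemma ClosedAdj.refl (x : V) : G.ClosedAdj x x := Or.inl rfl

lemma ClosedAdj.symm {x y : V} (h : G.ClosedAdj x y) : G.ClosedAdj y x :=
  h.imp Eq.symm Adj.symm

lemma closedAdj_comm {x y : V} : G.ClosedAdj x y ↔ G.ClosedAdj y x := ⟨.symm, .symm⟩

/-- A map into `G` that preserves and reflects closed adjacency is an induced embedding, provided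
that its source has no true twins. -/
lemma isIndContained_of_closedAdj {ι : Type*} {H : SimpleGraph ι} (f : ι → V)
    (hf : ∀ i j, G.ClosedAdj (f i) (f j) ↔ H.ClosedAdj i j)
    (hH : ∀ i j, (∀ k, H.ClosedAdj i k ↔ H.ClosedAdj j k) → i = j) : H ⊴ G := by
  have hinj : Function.Injective f := fun i j h => hH i j fun k => by rw [← hf, ← hf, h]
  refine ⟨⟨⟨f, hinj⟩, ?_⟩⟩
  intro i j
  have h := hf i j
  simp only [ClosedAdj, hinj.eq_iff] at h
  by_cases hij : i = j
  · simp [hij]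
  · simpa [hij] using h

open Classical in
/-- The Boolean value of closed adjacency. -/
noncomputable def closedAdjBool (G : SimpleGraph V) (x y : V) : Bool := decide (G.ClosedAdj x y)

lemma closedAdjBool_eq_true {x y : V} : G.closedAdjBool x y = true ↔ G.ClosedAdj x y := by
  simp [closedAdjBool]

lemma closedAdjBool_eq_false {x y : V} : G.closedAdjBool x y = false ↔ ¬ G.ClosedAdj x y := by
  simp [closedAdjBool]

lemma closedAdjBool_comm (x y : V) : G.closedAdjBool x y = G.closedAdjBool y x := by
  simp [closedAdjBool, closedAdj_comm]

/-- With respect to the closed adjacency `r`, the four entries of the list form a `C₄`, or its six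
entries form a `C₆` or a `2P₃`, in this order. -/
def isObstruction {α : Type*} (r : α → α → Bool) : List α → Bool
  | [a, b, c, d] => r a b && r b c && r c d && r d a && !r a c && !r b d
  | [a, b, c, d, e, f] =>
    r a b && r b c && r d e && r e f && !r a c && !r d f && !r a d && !r a e && !r b d && !r b e &&
      !r b f && !r c e && !r c f && (r c d == r f a)
  | _ => false

lemma isObstruction_map {α β : Type*} (r : β → β → Bool) (f : α → β) (l : List α) :
    isObstruction r (l.map f) = isObstruction (fun i j => r (f i) (f j)) l := by
  match l with
  | [] | [_] | [_, _] | [_, _, _] | [_, _, _, _] | [_, _, _, _, _] | [_, _, _, _, _, _]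
  | _ :: _ :: _ :: _ :: _ :: _ :: _ :: _ => rfl

/-- `G` has no induced `2P₃`, `C₄` or `C₆`. -/
def ObstructionFree (G : SimpleGraph V) : Prop :=
  ∀ l : List V, isObstruction G.closedAdjBool l = false

lemma obstructionFree_of_not_isIndContained (h2P3 : ¬ twoP3 ⊴ G) (hC4 : ¬ cycleGraph 4 ⊴ G)
    (hC6 : ¬ cycleGraph 6 ⊴ G) : G.ObstructionFree := by
  intro l
  have hr (x : V) : G.closedAdjBool x x = true := closedAdjBool_eq_true.2 (.refl x)
  match l with
  | [] | [_] | [_, _] | [_, _, _] | [_, _, _, _, _]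
  | _ :: _ :: _ :: _ :: _ :: _ :: _ :: _ => rfl
  | [a, b, c, d] =>
    by_contra h
    simp only [isObstruction, Bool.not_eq_false, Bool.and_eq_true, Bool.not_eq_true',
      closedAdjBool_eq_true, closedAdjBool_eq_false] at h
    obtain ⟨⟨⟨⟨⟨h1, h2⟩, h3⟩, h4⟩, h5⟩, h6⟩ := h
    refine hC4 (isIndContained_of_closedAdj ![a, b, c, d] ?_ ?_)
    · intro i j
      fin_cases i <;> fin_cases j <;>
        simp [ClosedAdj.refl, h1, h2, h3, h4, h5, h6, h1.symm, h2.symm, h3.symm, h4.symm,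
          mt ClosedAdj.symm h5, mt ClosedAdj.symm h6] <;> unfold ClosedAdj <;> decide
    · unfold ClosedAdj; decide
  | [a, b, c, d, e, f] =>
    by_contra h
    simp only [isObstruction, Bool.not_eq_false, Bool.and_eq_true, Bool.not_eq_true',
      closedAdjBool_eq_true, closedAdjBool_eq_false, beq_iff_eq] at h
    obtain ⟨⟨⟨⟨⟨⟨⟨⟨⟨⟨⟨⟨⟨h1, h2⟩, h3⟩, h4⟩, h5⟩, h6⟩, h7⟩, h8⟩, h9⟩, h10⟩, h11⟩, h12⟩, h13⟩, h14⟩ := h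
    -- The last condition equates the pairs `c d` and `f a`: both nonadjacent gives `2P₃`, both
    -- adjacent gives `C₆`.
    cases hcd : G.closedAdjBool c d
    · have hfa := h14.symm.trans hcd
      rw [closedAdjBool_eq_false] at hcd hfa
      refine h2P3 (isIndContained_of_closedAdj (Sum.elim ![a, b, c] ![d, e, f]) ?_ ?_)
      · rintro (i | i) (j | j) <;> fin_cases i <;> fin_cases j <;>
          simp [ClosedAdj.refl, h1, h2, h3, h4, h5, h6, h7, h8, h9, h10, h11, h12, h13, h1.symm,
            h2.symm, h3.symm, h4.symm, mt ClosedAdj.symm h5, mt ClosedAdj.symm h6,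
            mt ClosedAdj.symm h7, mt ClosedAdj.symm h8, mt ClosedAdj.symm h9,
            mt ClosedAdj.symm h10, mt ClosedAdj.symm h11, mt ClosedAdj.symm h12,
            mt ClosedAdj.symm h13, hcd, hfa, mt ClosedAdj.symm hcd, mt ClosedAdj.symm hfa] <;>
          simp [ClosedAdj, twoP3, pathGraph_adj]
      · rintro (i | i) (j | j) h
        all_goals
          have h0 := h (.inl 0)
          have h1 := h (.inl 1)
          have h2 := h (.inl 2)
          have h3 := h (.inr 0)
          have h4 := h (.inr 1)
          have h5 := h (.inr 2)
          clear h
          revert h0 h1 h2 h3 h4 h5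
          fin_cases i <;> fin_cases j <;> simp [ClosedAdj, twoP3, pathGraph_adj]
    · have hfa := h14.symm.trans hcd
      rw [closedAdjBool_eq_true] at hcd hfa
      refine hC6 (isIndContained_of_closedAdj ![a, b, c, d, e, f] ?_ ?_)
      · intro i j
        fin_cases i <;> fin_cases j <;>
          simp [ClosedAdj.refl, h1, h2, h3, h4, h5, h6, h7, h8, h9, h10, h11, h12, h13, h1.symm,
            h2.symm, h3.symm, h4.symm, mt ClosedAdj.symm h5, mt ClosedAdj.symm h6,
            mt ClosedAdj.symm h7, mt ClosedAdj.symm h8, mt ClosedAdj.symm h9,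
            mt ClosedAdj.symm h10, mt ClosedAdj.symm h11, mt ClosedAdj.symm h12,
            mt ClosedAdj.symm h13, hcd, hfa, hcd.symm, hfa.symm] <;> unfold ClosedAdj <;> decide
      · unfold ClosedAdj; decide

/-- A nonempty class of vertices that induces no `P₃`, and whose outside neighbours of any two
closed-adjacent members form a clique, contains a simplicial vertex. -/
lemma exists_isSimplicialVertex [Finite V] (hG : G.ObstructionFree) (P : V → Prop)
    (hne : ∃ x, P x)
    (hP : ∀ x y z, P x → P y → P z → G.ClosedAdj x y → G.ClosedAdj y z → G.ClosedAdj x z)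
    (hout : ∀ x y w z, P x → P y → ¬ P w → ¬ P z → G.ClosedAdj x y → G.ClosedAdj y w →
      G.ClosedAdj x z → G.ClosedAdj w z) : ∃ x, IsSimplicialVertex G x := by
  -- Take `x` with a smallest closed neighbourhood. If `y` in the class, adjacent to `x`, missed an
  -- outside neighbour `z` of `x`, it would have a neighbour `w` missed by `x`, and `x y w z` would
  -- be a `C₄`.
  obtain ⟨x, hx, hmin⟩ := Set.exists_min_image {x | P x} (fun x => {y | G.ClosedAdj x y}.ncard)
    (Set.toFinite _) hne
  refine ⟨x, ?_⟩
  have key : ∀ y z, P y → ¬ P z → G.ClosedAdj x y → G.ClosedAdj x z → G.ClosedAdj y z := by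
    intro y z hy hz hxy hxz
    by_contra hyz
    obtain ⟨w, hw, hxw⟩ : ∃ w, G.ClosedAdj y w ∧ ¬ G.ClosedAdj x w := by
      by_contra! hsub
      have hss : {w | G.ClosedAdj y w} ⊂ {w | G.ClosedAdj x w} :=
        ⟨fun w hw => hsub w hw, fun h => hyz (h hxz)⟩
      exact absurd (hmin y hy) (not_le.2 (Set.ncard_lt_ncard hss))
    have hPw : ¬ P w := fun h => hxw (hP x y w hx hy h hxy hw)
    have hwz := hout x y w z hx hy hPw hz hxy hw hxz
    have := hG [x, y, w, z]
    simp [isObstruction, closedAdjBool, hxy, hw, hwz, hxz.symm, hxw, hyz] at this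
  intro y hy z hz hyz
  have hxy : G.ClosedAdj x y := .inr hy
  have hxz : G.ClosedAdj x z := .inr hz
  have : G.ClosedAdj y z := by
    by_cases h1 : P y <;> by_cases h2 : P z
    · exact hP y x z h1 hx h2 hxy.symm hxz
    · exact key y z h1 h2 hxy hxz
    · exact (key z y h2 h1 hxz hxy).symm
    · exact hout x x y z hx hx h1 h2 (.refl x) hxy hxz
  exact this.resolve_left hyz

end SimpleGraph

/-! ### Clique-width of blow-ups into cliques -/

section CliqueWidth

open SimpleGraph

variable {V : Type*} {k : ℕ}

/-- The subgraph of `H` induced by `S`, with labels given by `g`, can be constructed with `k`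
labels. -/
def LabelledConstructible (S : Set V) (g : V → Fin k) (H : SimpleGraph V) : Prop :=
  ∃ (e : CWExpr k) (φ : e.Vert → V), Function.Injective φ ∧ Set.range φ = S ∧
    (∀ x y, e.graph.Adj x y ↔ H.Adj (φ x) (φ y)) ∧ ∀ x, e.label x = g (φ x)

namespace LabelledConstructible

variable {S T : Set V} {g g' : V → Fin k} {H H' : SimpleGraph V}

lemma congr (h : LabelledConstructible S g H) (hg : ∀ x ∈ S, g x = g' x)
    (hH : ∀ x ∈ S, ∀ y ∈ S, H.Adj x y ↔ H'.Adj x y) : LabelledConstructible S g' H' := by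
  obtain ⟨e, φ, hφ, rfl, hadj, hlab⟩ := h
  exact ⟨e, φ, hφ, rfl, fun x y => (hadj x y).trans (hH _ ⟨x, rfl⟩ _ ⟨y, rfl⟩),
    fun x => (hlab x).trans (hg _ ⟨x, rfl⟩)⟩

lemma singleton (v : V) (g : V → Fin k) (H : SimpleGraph V) : LabelledConstructible {v} g H :=
  ⟨.vertex (g v), fun _ => v, fun x y _ => Subsingleton.elim (α := Unit) x y,
    Set.range_const (ι := Unit), fun x y => by simp [CWExpr.graph], fun _ => rfl⟩

lemma union (hS : LabelledConstructible S g H) (hT : LabelledConstructible T g H)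
    (hdisj : Disjoint S T) (hST : ∀ x ∈ S, ∀ y ∈ T, ¬ H.Adj x y) :
    LabelledConstructible (S ∪ T) g H := by
  obtain ⟨e, φ, hφ, rfl, hadj, hlab⟩ := hS
  obtain ⟨f, ψ, hψ, rfl, hadj', hlab'⟩ := hT
  refine ⟨.union e f, Sum.elim φ ψ, ?_, Set.Sum.elim_range φ ψ, ?_, ?_⟩
  · exact hφ.sumElim hψ fun a b => hdisj.ne_of_mem ⟨a, rfl⟩ ⟨b, rfl⟩
  · rintro (x | x) (y | y)
    · simpa [CWExpr.graph] using hadj x y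
    · simpa [CWExpr.graph] using hST _ ⟨x, rfl⟩ _ ⟨y, rfl⟩
    · simpa [CWExpr.graph, SimpleGraph.adj_comm] using hST _ ⟨y, rfl⟩ _ ⟨x, rfl⟩
    · simpa [CWExpr.graph] using hadj' x y
  · rintro (x | x)
    · exact hlab x
    · exact hlab' x

lemma join {i j : Fin k} (hij : i ≠ j) (h : LabelledConstructible S g H)
    (hH : ∀ x ∈ S, ∀ y ∈ S,
      H'.Adj x y ↔ H.Adj x y ∨ (g x = i ∧ g y = j) ∨ (g y = i ∧ g x = j)) :
    LabelledConstructible S g H' := by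
  obtain ⟨e, φ, hφ, rfl, hadj, hlab⟩ := h
  refine ⟨.join i j hij e, φ, hφ, rfl, fun (x y : e.Vert) => ?_, hlab⟩
  change (e.graph ⊔ SimpleGraph.fromRel fun x y => e.label x = i ∧ e.label y = j).Adj x y ↔
    H'.Adj (φ x) (φ y)
  rw [hH _ ⟨x, rfl⟩ _ ⟨y, rfl⟩, ← hadj, ← hlab, ← hlab, SimpleGraph.sup_adj,
    SimpleGraph.fromRel_adj]
  refine or_congr_right (and_iff_right_of_imp ?_)
  rintro (⟨h1, h2⟩ | ⟨h1, h2⟩) rfl <;> exact hij (h1.symm.trans h2)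

lemma rename (i j : Fin k) (h : LabelledConstructible S g H) :
    LabelledConstructible S (fun x => if g x = i then j else g x) H := by
  obtain ⟨e, φ, hφ, rfl, hadj, hlab⟩ := h
  exact ⟨.rename i j e, φ, hφ, rfl, hadj, fun (x : e.Vert) => by
    change (if e.label x = i then j else e.label x) = if g (φ x) = i then j else g (φ x)
    rw [hlab]⟩

lemma rename_all (i : Fin k) (h : LabelledConstructible S g H) :
    LabelledConstructible S (fun _ => i) H := by
  suffices ∀ I : Finset (Fin k),
      LabelledConstructible S (fun x => if g x ∈ I then i else g x) H by
    simpa using this Finset.univ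
  intro I
  induction I using Finset.induction_on with
  | empty => simpa using h
  | insert a I _ ih =>
    refine (ih.rename a i).congr (fun x _ => ?_) fun _ _ _ _ => Iff.rfl
    simp only [Finset.mem_insert]
    grind

/-- The label `j` marks only the new vertex and is freed by the final renaming, so two labels
suffice for any number of universal vertices. -/
lemma insert_universal {i j : Fin k} (hij : i ≠ j) {v : V} (hv : v ∉ S)
    (h : LabelledConstructible S (fun _ => i) H) (hadj : ∀ x ∈ S, H.Adj v x) :
    LabelledConstructible (insert v S) (fun _ => i) H := by
  classical
  have hne : ∀ x ∈ S, x ≠ v := fun x hx h => hv (h ▸ hx)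
  -- The graph before the join, in which `v` is isolated.
  let H₀ : SimpleGraph V :=
    { Adj := fun x y => H.Adj x y ∧ x ≠ v ∧ y ≠ v
      symm := ⟨fun x y h => ⟨h.1.symm, h.2.2, h.2.1⟩⟩
      loopless := ⟨fun x h => H.irrefl h.1⟩ }
  let g₀ : V → Fin k := fun x => if x = v then j else i
  have h1 : LabelledConstructible S g₀ H₀ := h.congr (fun x hx => by simp [g₀, hne x hx])
    fun x hx y hy => by simp [H₀, hne x hx, hne y hy]
  have h2 : LabelledConstructible (insert v S) g₀ H₀ := by
    rw [← Set.singleton_union]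
    refine (singleton v g₀ H₀).union h1 (Set.disjoint_singleton_left.2 hv) ?_
    rintro x rfl y _
    simp [H₀]
  have h3 : LabelledConstructible (insert v S) g₀ H := by
    refine h2.join hij ?_
    rintro x (rfl | hx) y (rfl | hy)
    · simp [H₀, g₀, hij.symm]
    · simp [H₀, g₀, hne y hy, hadj y hy]
    · simp [H₀, g₀, hne x hx, (hadj x hx).symm]
    · simp [H₀, g₀, hne x hx, hne y hy, hij]
  refine (h3.rename j i).congr (fun x _ => ?_) fun _ _ _ _ => Iff.rfl
  by_cases hx : x = v <;> simp [g₀, hx]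

lemma union_universal {i j : Fin k} (hij : i ≠ j) (hT : T.Finite)
    (h : LabelledConstructible S (fun _ => i) H)
    (hadj : ∀ u ∈ T, ∀ x ∈ S ∪ T, u ≠ x → H.Adj u x) :
    LabelledConstructible (S ∪ T) (fun _ => i) H := by
  induction T, hT using Set.Finite.induction_on with
  | empty => simpa using h
  | @insert a T _ _ ih =>
    have ih' := ih fun u hu x hx => hadj u (.inr hu) x (hx.imp_right .inr)
    rw [Set.union_insert]
    by_cases ha : a ∈ S ∪ T
    · rwa [Set.insert_eq_of_mem ha]
    · exact ih'.insert_universal hij ha fun x hx =>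
        hadj a (.inl rfl) x (hx.imp_right .inr) fun hax => ha (hax ▸ hx)

lemma clique {i j : Fin k} (hij : i ≠ j) (hT : T.Finite) (hne : T.Nonempty)
    (hadj : ∀ x ∈ T, ∀ y ∈ T, x ≠ y → H.Adj x y) :
    LabelledConstructible T (fun _ => i) H := by
  obtain ⟨v, hv⟩ := hne
  have := (singleton v (fun _ => i) H).union_universal hij hT fun u hu x hx =>
    hadj u hu x (hx.elim (fun h => h ▸ hv) id)
  rwa [Set.singleton_union, Set.insert_eq_of_mem hv] at this

lemma constructibleWithLabels (h : LabelledConstructible Set.univ g H) :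
    ConstructibleWithLabels H k := by
  obtain ⟨e, φ, hφ, hr, hadj, -⟩ := h
  exact ⟨e, ⟨Equiv.ofBijective φ ⟨hφ, Set.range_eq_univ.1 hr⟩, (hadj _ _).symm⟩⟩

end LabelledConstructible

open LabelledConstructible

/-- A blow-up of a graph with labelled vertices into cliques can be constructed with these labels,
provided that there are at least two. -/
lemma labelledConstructible_of_closedAdj_congr {G : SimpleGraph V} {S : Set V} (hk : 2 ≤ k)
    (hS : S.Finite) (hne : S.Nonempty) (f : V → Fin k)
    (hf : ∀ x ∈ S, ∀ y ∈ S, ∀ x' ∈ S, ∀ y' ∈ S, f x = f x' → f y = f y' →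
      G.ClosedAdj x y → G.ClosedAdj x' y') : LabelledConstructible S f G := by
  classical
  have hother (i : Fin k) : ∃ j, i ≠ j := by
    have : Nontrivial (Fin k) := Fin.nontrivial_iff_two_le.2 hk
    exact (exists_ne i).imp fun _ h => h.symm
  -- adjacency inside the classes and between the pairs of classes in `L`
  let H (L : Finset (Fin k × Fin k)) : SimpleGraph V :=
    SimpleGraph.fromRel fun x y => f x = f y ∨ (f x, f y) ∈ L
  have hH (L) (x y : V) : (H L).Adj x y ↔
      x ≠ y ∧ (f x = f y ∨ (f x, f y) ∈ L ∨ (f y, f x) ∈ L) := by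
    simp only [H, SimpleGraph.fromRel_adj, eq_comm (a := f y)]
    tauto
  -- Each class is built on its own before the disjoint union, so the auxiliary label of its clique
  -- may be the label of another class.
  have hclasses : ∀ I : Finset (Fin k), (S ∩ {x | f x ∈ I}).Nonempty →
      LabelledConstructible (S ∩ {x | f x ∈ I}) f (H ∅) := by
    intro I
    induction I using Finset.induction_on with
    | empty => simp
    | insert a I ha ih =>
      have hsplit : S ∩ {x | f x ∈ insert a I} = (S ∩ {x | f x ∈ I}) ∪ (S ∩ {x | f x = a}) := by
        ext x
        simp only [Finset.mem_insert, Set.mem_inter_iff, Set.mem_ofPred_eq, Set.mem_union]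
        tauto
      obtain ⟨b, hb⟩ := hother a
      have hclass (h : (S ∩ {x | f x = a}).Nonempty) :
          LabelledConstructible (S ∩ {x | f x = a}) f (H ∅) := by
        refine (clique hb (hS.inter_of_left _) h (H := H ∅) fun x hx y hy hxy => ?_).congr
          (fun x hx => hx.2.symm) fun _ _ _ _ => Iff.rfl
        exact (hH _ _ _).2 ⟨hxy, .inl (hx.2.trans hy.2.symm)⟩
      rw [hsplit]
      intro hne
      rcases (S ∩ {x | f x ∈ I}).eq_empty_or_nonempty with h1 | h1
      · rw [h1, Set.empty_union] at hne ⊢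
        exact hclass hne
      rcases (S ∩ {x | f x = a}).eq_empty_or_nonempty with h2 | h2
      · rw [h2, Set.union_empty]
        exact ih h1
      have hxy : ∀ x ∈ S ∩ {x | f x ∈ I}, ∀ y ∈ S ∩ {x | f x = a}, f x ≠ f y := by
        rintro x ⟨-, hx⟩ y ⟨-, hy⟩ h
        rw [Set.mem_ofPred_eq] at hx hy
        exact ha (hy ▸ h ▸ hx)
      refine (ih h1).union (hclass h2) ?_ fun x hx y hy h => ?_
      · exact Set.disjoint_left.2 fun x hx hx' => hxy x hx x hx' rfl
      · simpa [hxy x hx y hy] using ((hH _ _ _).1 h).2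
  have hjoins : ∀ L : Finset (Fin k × Fin k), (∀ p ∈ L, p.1 ≠ p.2) →
      LabelledConstructible S f (H L) := by
    intro L
    induction L using Finset.induction_on with
    | empty =>
      intro _
      simpa using hclasses Finset.univ (by simpa using hne)
    | insert p L _ ih =>
      intro hL
      refine (ih fun q hq => hL q (Finset.mem_insert_of_mem hq)).join
        (hL p (Finset.mem_insert_self _ _)) fun x _ y _ => ?_
      have hp := hL p (Finset.mem_insert_self _ _)
      rw [hH, hH]
      simp only [Finset.mem_insert, Prod.ext_iff]
      constructor
      · tauto
      · rintro (h | ⟨h1, h2⟩ | ⟨h1, h2⟩)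
        · tauto
        · exact ⟨fun h => hp (by rw [← h1, ← h2, h]), .inr (.inl (.inl ⟨h1, h2⟩))⟩
        · exact ⟨fun h => hp (by rw [← h1, ← h2, h]), .inr (.inr (.inl ⟨h1, h2⟩))⟩
  let L : Finset (Fin k × Fin k) := Finset.univ.filter fun p =>
    p.1 ≠ p.2 ∧ ∃ x ∈ S, ∃ y ∈ S, f x = p.1 ∧ f y = p.2 ∧ G.ClosedAdj x y
  have hL (x y : V) : (f x, f y) ∈ L ↔
      f x ≠ f y ∧ ∃ x' ∈ S, ∃ y' ∈ S, f x' = f x ∧ f y' = f y ∧ G.ClosedAdj x' y' := by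
    simp [L]
  refine (hjoins L fun p hp => (Finset.mem_filter.1 hp).2.1).congr (fun _ _ => rfl)
    fun x hx y hy => ?_
  rw [hH]
  constructor
  · rintro ⟨hxy, h⟩
    suffices G.ClosedAdj x y from this.resolve_left hxy
    rcases h with h | h | h
    -- Since `x` is closed-adjacent to itself, `hf` makes every class a clique.
    · exact hf x hx x hx x hx y hy rfl h (.refl x)
    · obtain ⟨-, x', hx', y', hy', h1, h2, h3⟩ := (hL x y).1 h
      exact hf x' hx' y' hy' x hx y hy h1 h2 h3
    · obtain ⟨-, y', hy', x', hx', h1, h2, h3⟩ := (hL y x).1 h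
      exact hf x' hx' y' hy' x hx y hy h2 h1 h3.symm
  · intro h
    refine ⟨h.ne, ?_⟩
    by_cases hxy : f x = f y
    · exact .inl hxy
    · exact .inr (.inl ((hL x y).2 ⟨hxy, x, hx, y, hy, rfl, rfl, .inr h⟩))

/-- Once the vertices outside `U` are built, their labels are no longer needed and can be merged;
this frees a label for adding `U`. -/
lemma constructibleWithLabels_of_closedAdj_congr [Finite V] [Nonempty V] {G : SimpleGraph V}
    (hk : 2 ≤ k) (U : Set V) (hU : ∀ u ∈ U, ∀ x, G.ClosedAdj u x) (f : V → Fin k)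
    (hf : ∀ x ∉ U, ∀ y ∉ U, ∀ x' ∉ U, ∀ y' ∉ U, f x = f x' → f y = f y' →
      G.ClosedAdj x y → G.ClosedAdj x' y') : ConstructibleWithLabels G k := by
  obtain ⟨i, j, hij⟩ : ∃ i j : Fin k, i ≠ j := ⟨⟨0, by lia⟩, ⟨1, by lia⟩, by simp⟩
  have hadj : ∀ u ∈ U, ∀ x, u ≠ x → G.Adj u x := fun u hu x => (hU u hu x).resolve_left
  rcases (Uᶜ).eq_empty_or_nonempty with h | h
  · rw [Set.compl_empty_iff] at h
    exact constructibleWithLabels (clique hij Set.finite_univ Set.univ_nonempty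
      fun x _ y _ => hadj x (h ▸ Set.mem_univ x) y)
  · have h1 := labelledConstructible_of_closedAdj_congr hk (Set.toFinite Uᶜ) h f hf
    have h2 := (h1.rename_all i).union_universal hij (Set.toFinite U) fun u hu x _ => hadj u hu x
    rw [Set.compl_union_self] at h2
    exact h2.constructibleWithLabels

lemma cliqueWidth_le {G : SimpleGraph V} (h : ConstructibleWithLabels G k) :
    cliqueWidth G ≤ k :=
  iInf₂_le k h

end CliqueWidth

/-! ### Types of vertices over an induced subgraph -/

namespace SimpleGraph

variable {V : Type*} {G : SimpleGraph V} {n : ℕ} {row : ℕ → ℕ} {v : ℕ → V}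

/-- The first `n` values of `v` induce the graph in which the closed neighbourhood of `i` has the
binary code `row i`. -/
def Realizes (G : SimpleGraph V) (n : ℕ) (row : ℕ → ℕ) (v : ℕ → V) : Prop :=
  ∀ i < n, ∀ j < n, G.closedAdjBool (v i) (v j) = (row i).testBit j

/-- The binary code of the set of the indices `i < n` for which `x` is equal or adjacent to
`v i`. -/
noncomputable def typeCode (G : SimpleGraph V) (n : ℕ) (v : ℕ → V) (x : V) : ℕ :=
  Nat.ofBits fun i : Fin n => G.closedAdjBool x (v i)

lemma testBit_typeCode (x : V) {i : ℕ} (hi : i < n) :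
    (G.typeCode n v x).testBit i = G.closedAdjBool x (v i) := by
  simp [typeCode, hi]

lemma typeCode_lt (x : V) : G.typeCode n v x < 2 ^ n := Nat.ofBits_lt_two_pow _

/-- The closed adjacency on the first `n` natural numbers given by `row`, extended by a vertex `n`
with code `m₁` and by a vertex with code `m₂` at all the larger numbers, where `e` tells whether
these two are adjacent. -/
def pairCode (n : ℕ) (row : ℕ → ℕ) (m₁ m₂ : ℕ) (e : Bool) (i j : ℕ) : Bool :=
  if i < n then
    if j < n then (row i).testBit j else if j = n then m₁.testBit i else m₂.testBit i
  else if j < n then if i = n then m₁.testBit j else m₂.testBit j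
  else (i == n) == (j == n) || e

/-- None of the listed tuples is an obstruction. -/
def compatible (n : ℕ) (row : ℕ → ℕ) (cert : List (List ℕ)) (m₁ m₂ : ℕ) (e : Bool) : Bool :=
  cert.all fun l => !isObstruction (pairCode n row m₁ m₂ e) l

/-- Each listed tuple is the pattern of an actual tuple of vertices, so any `cert` is admissible.
The vertices `x` and `y` may coincide with each other or lie in the copy. -/
lemma ObstructionFree.compatible (hG : G.ObstructionFree) (hv : G.Realizes n row v)
    (cert : List (List ℕ)) (x y : V) :
    compatible n row cert (G.typeCode n v x) (G.typeCode n v y) (G.closedAdjBool x y) = true := by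
  let f : ℕ → V := fun i => if i < n then v i else if i = n then x else y
  have hf : pairCode n row (G.typeCode n v x) (G.typeCode n v y) (G.closedAdjBool x y) =
      fun i j => G.closedAdjBool (f i) (f j) := by
    have hr (x : V) : G.closedAdjBool x x = true := closedAdjBool_eq_true.2 (.refl x)
    funext i j
    by_cases hi : i < n <;> by_cases hj : j < n
    · simp [pairCode, f, hi, hj, hv i hi j hj]
    · by_cases hjn : j = n <;>
        simp [pairCode, f, hi, hj, hjn, testBit_typeCode _ hi, closedAdjBool_comm (v i)]
    · by_cases hin : i = n <;> simp [pairCode, f, hi, hj, hin, testBit_typeCode _ hj]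
    · by_cases hin : i = n <;> by_cases hjn : j = n <;>
        simp [pairCode, f, hi, hj, hin, hjn, hr, closedAdjBool_comm y x]
  rw [SimpleGraph.compatible, List.all_eq_true]
  intro l _
  rw [hf, ← isObstruction_map, hG]
  rfl

lemma ObstructionFree.compatible' (hG : G.ObstructionFree) (hv : G.Realizes n row v)
    (cert : List (List ℕ)) {x y : V} {m₁ m₂ : ℕ} {e : Bool} (hx : G.typeCode n v x = m₁)
    (hy : G.typeCode n v y = m₂) (hxy : G.closedAdjBool x y = e) :
    SimpleGraph.compatible n row cert m₁ m₂ e = true := by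
  subst hx hy hxy
  exact hG.compatible hv cert x y

/-- Criterion for excluding a type: `A` bounds the types of the outside neighbours of the class, and
`hAA` turns these neighbours into a clique, which would produce a simplicial vertex. -/
lemma typeCode_ne_of_forall_not_isSimplicialVertex [Finite V] (hG : G.ObstructionFree)
    (hsimp : ∀ x, ¬ IsSimplicialVertex G x) (c : ℕ) (A : ℕ → Prop)
    (hP : ∀ x y z, G.typeCode n v x = c → G.typeCode n v y = c → G.typeCode n v z = c →
      G.ClosedAdj x y → G.ClosedAdj y z → G.ClosedAdj x z)
    (hA : ∀ x w, G.typeCode n v x = c → G.typeCode n v w ≠ c → G.ClosedAdj x w →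
      A (G.typeCode n v w))
    (hAA : ∀ x y w z, G.typeCode n v x = c → G.typeCode n v y = c → G.ClosedAdj y w →
      G.ClosedAdj x z → A (G.typeCode n v w) → A (G.typeCode n v z) → G.ClosedAdj w z) (x : V) : G.typeCode n v x ≠ c := by
  intro hx
  obtain ⟨s, hs⟩ := exists_isSimplicialVertex hG (fun x => G.typeCode n v x = c) ⟨x, hx⟩ hP
    fun x y w z hx hy hw hz _ hyw hxz =>
      hAA x y w z hx hy hyw hxz (hA y w hy hw hyw) (hA x z hx hz hxz)
  exact hsimp s hs

/-- Vertices of empty type see nothing of the copy, so an induced path among them forms a `2P₃` with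
the path `v a`, `v b`, `v c`. -/
lemma typeCode_zero_no_induced_path (hG : G.ObstructionFree) (hv : G.Realizes n row v)
    {a b c : ℕ} (ha : a < n) (hb : b < n) (hc : c < n) (hab : (row a).testBit b = true)
    (hbc : (row b).testBit c = true) (hac : (row a).testBit c = false) {x y z : V}
    (hx : G.typeCode n v x = 0) (hy : G.typeCode n v y = 0) (hz : G.typeCode n v z = 0)
    (hxy : G.ClosedAdj x y) (hyz : G.ClosedAdj y z) : G.ClosedAdj x z := by
  by_contra hxz
  have h0 {x : V} (hx : G.typeCode n v x = 0) {i : ℕ} (hi : i < n) :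
      G.closedAdjBool x (v i) = false := by
    rw [← testBit_typeCode x hi, hx, Nat.zero_testBit]
  have := hG [x, y, z, v a, v b, v c]
  simp [isObstruction, h0 hx, h0 hy, h0 hz, ha, hb, hc, hv a ha b hb, hv b hb c hc, hv a ha c hc,
    hab, hbc, hac, closedAdjBool_eq_true.2 hxy, closedAdjBool_eq_true.2 hyz,
    closedAdjBool_eq_false.2 hxz, closedAdjBool_comm (v c)] at this

lemma constructibleWithLabels_of_typeCode [Finite V] [Nonempty V] {k : ℕ} (hk : 2 ≤ k)
    (t : V → ℕ) (T : Finset ℕ) (hT : T.card ≤ k) (c : ℕ) (ht : ∀ x, t x ≠ c → t x ∈ T)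
    (hc : ∀ u x, t u = c → G.ClosedAdj u x)
    (hdet : ∀ x y x' y', t x = t x' → t y = t y' → G.ClosedAdj x y → G.ClosedAdj x' y') :
    ConstructibleWithLabels G k := by
  obtain ⟨g, hg⟩ : ∃ g : ℕ → Fin k, Set.InjOn g T := by
    classical
    refine ⟨fun m => if h : m ∈ T then (T.equivFin ⟨m, h⟩).castLE hT else ⟨0, by lia⟩, ?_⟩
    intro a ha b hb hab
    rw [Finset.mem_coe] at ha hb
    simpa [ha, hb] using hab
  refine constructibleWithLabels_of_closedAdj_congr hk {u | t u = c} (fun u hu x => hc u x hu)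
    (fun x => g (t x)) fun x hx y hy x' hx' y' hy' h1 h2 => ?_
  exact hdet x y x' y' (hg (ht x hx) (ht x' hx') h1) (hg (ht y hy) (ht y' hy') h2)

/-- By `hcert` no pair of types admits both an adjacent and a nonadjacent pair of vertices; the case
`m₁ = m₂` says that each type is a clique. -/
lemma closedAdj_congr_of_typeCode (hG : G.ObstructionFree) (hv : G.Realizes n row v)
    (cert : List (List ℕ)) (L : List ℕ) (hL : ∀ x, G.typeCode n v x ∈ L)
    (hcert : ∀ m₁ ∈ L, ∀ m₂ ∈ L, m₁ ≤ m₂ → compatible n row cert m₁ m₂ true = true →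
      compatible n row cert m₁ m₂ false = false) (x y x' y' : V)
    (hx : G.typeCode n v x = G.typeCode n v x') (hy : G.typeCode n v y = G.typeCode n v y')
    (hxy : G.ClosedAdj x y) : G.ClosedAdj x' y' := by
  have key {x y x' y' : V} (hle : G.typeCode n v x ≤ G.typeCode n v y)
      (hx : G.typeCode n v x = G.typeCode n v x') (hy : G.typeCode n v y = G.typeCode n v y')
      (hxy : G.ClosedAdj x y) : G.ClosedAdj x' y' := by
    by_contra h
    have h1 := hcert _ (hL x) _ (hL y) hle
      (hG.compatible' hv cert rfl rfl (closedAdjBool_eq_true.2 hxy))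
    rw [hG.compatible' hv cert hx.symm hy.symm (closedAdjBool_eq_false.2 h)] at h1
    cases h1
  rcases le_total (G.typeCode n v x) (G.typeCode n v y) with h | h
  · exact key h hx hy hxy
  · exact (key h hy hx hxy.symm).symm

/-! ### Graphs with an induced `C₇` -/

/-- Codes of the closed neighbourhoods in `C₇`. -/
def rowC7 (i : ℕ) : ℕ := [67, 7, 14, 28, 56, 112, 97].getD i 0

/-- Codes of the sets `{i, i + 1, i + 4}`. -/
def splitC7 : Fin 7 → ℕ := ![19, 38, 76, 25, 50, 100, 73]

/-- Codes of the sets of five consecutive vertices. -/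
def longC7 : Fin 7 → ℕ := ![31, 62, 124, 121, 115, 103, 79]

/-- Potential obstructions in an extension of `C₇` by two vertices, closed under rotations. -/
def certC7 : List (List ℕ) :=
  (List.range 7).flatMap fun k =>
    [[0, 7, 3, 8], [0, 1, 2, 7], [0, 1, 8, 7], [0, 7, 2, 8], [0, 1, 7, 8], [0, 1, 2, 3, 4, 7],
      [0, 1, 2, 5, 4, 7], [0, 1, 2, 8, 4, 7], [0, 1, 2, 8, 5, 7], [0, 1, 2, 7, 5, 8],
      [0, 1, 2, 7, 4, 8], [0, 1, 2, 4, 8, 7], [0, 1, 2, 3, 7, 8], [0, 1, 7, 4, 3, 8],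
      [0, 1, 7, 3, 4, 8], [0, 1, 8, 5, 4, 7], [1, 0, 7, 4, 5, 8], [0, 1, 7, 4, 5, 8],
      [1, 2, 3, 4, 8, 7]].map
      (List.map fun i => if i < 7 then (i + k) % 7 else i)

/-- The codes of the nonempty types of vertices over an induced `C₇`. -/
def IsTypeC7 (m : ℕ) : Prop :=
  (∃ i : Fin 7, m = rowC7 i) ∨ (∃ i, m = splitC7 i) ∨ (∃ i, m = longC7 i) ∨ m = 127

instance : DecidablePred IsTypeC7 := fun m => by unfold IsTypeC7; infer_instance

/-- Here a vertex is paired with itself, whence the equal codes and the value `true`. -/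
lemma isTypeC7_of_compatible :
    ∀ m < 2 ^ 7, compatible 7 rowC7 certC7 m m true = true → m = 0 ∨ IsTypeC7 m := by
  decide +kernel

/-- The codes of the nonempty types of vertices over an induced `C₇`. -/
def typesC7 : List ℕ :=
  [7, 14, 19, 25, 28, 31, 38, 50, 56, 62, 67, 73, 76, 79, 97, 100, 103, 112, 115, 121, 124, 127]

lemma IsTypeC7.mem_typesC7 {m : ℕ} (h : IsTypeC7 m) : m ∈ typesC7 := by
  rcases h with ⟨i, rfl⟩ | ⟨i, rfl⟩ | ⟨i, rfl⟩ | rfl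
  · revert i; decide
  · revert i; decide
  · revert i; decide
  · decide

lemma not_compatible_both_C7 : ∀ m₁ ∈ typesC7, ∀ m₂ ∈ typesC7, m₁ ≤ m₂ →
    compatible 7 rowC7 certC7 m₁ m₂ true = true →
    compatible 7 rowC7 certC7 m₁ m₂ false = false := by
  decide +kernel

/-- The two types exclude each other, whether or not their vertices are adjacent. The tuples in
`certC7` are not symmetric in the two added vertices, so both orders are tested. -/
lemma not_compatible_splitC7 : ∀ i : Fin 7, ∀ e, ∀ j ∈ [i + 1, i + 2],
    compatible 7 rowC7 certC7 (splitC7 i) (splitC7 j) e = true →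
    compatible 7 rowC7 certC7 (splitC7 j) (splitC7 i) e = false := by
  decide +kernel

lemma not_compatible_longC7 : ∀ i : Fin 7, ∀ e,
    compatible 7 rowC7 certC7 (longC7 i) (longC7 (i + 2)) e = true →
    compatible 7 rowC7 certC7 (longC7 (i + 2)) (longC7 i) e = false := by
  decide +kernel

lemma compatible_zero_C7 : ∀ m ∈ typesC7, compatible 7 rowC7 certC7 0 m true = true →
    ∀ i : Fin 7, m ≠ rowC7 i := by
  decide +kernel

lemma compatible_full_C7 : ∀ m ∈ typesC7, compatible 7 rowC7 certC7 m 127 false = false := by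
  decide +kernel

/-- A vertex with code `m₁` and neighbour `y` outside the cycle and a vertex with code `m₂` have a
common neighbour on the cycle, and the paths `y w a` and `b z c` form a `2P₃` for some vertices
`a`, `b`, `c` of the cycle. -/
def HasPathsC7 (m₁ m₂ : ℕ) : Prop :=
  (∃ i < 7, m₁.testBit i = true ∧ m₂.testBit i = true) ∧ ∃ a < 7, ∃ b < 7, ∃ c < 7,
    m₁.testBit a = true ∧ m₂.testBit b = true ∧ m₂.testBit c = true ∧ m₂.testBit a = false ∧
      m₁.testBit b = false ∧ m₁.testBit c = false ∧ (rowC7 a).testBit b = false ∧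
      (rowC7 a).testBit c = false ∧ (rowC7 b).testBit c = false

instance (m₁ m₂ : ℕ) : Decidable (HasPathsC7 m₁ m₂) := by unfold HasPathsC7; infer_instance

lemma hasPathsC7_or_hasPathsC7 : ∀ m₁ ∈ typesC7, ∀ m₂ ∈ typesC7, (∀ i : Fin 7, m₁ ≠ rowC7 i) →
    (∀ i : Fin 7, m₂ ≠ rowC7 i) → compatible 7 rowC7 certC7 m₁ m₂ false = true →
    compatible 7 rowC7 certC7 m₂ m₁ false = true → HasPathsC7 m₁ m₂ ∨ HasPathsC7 m₂ m₁ := by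
  decide +kernel

/-- Let `w` and `z` be nonadjacent. If `y` is adjacent to `z`, then `y`, `w`, a common neighbour on
the cycle and `z` form a `C₄`; otherwise the two paths form a `2P₃`. -/
lemma ObstructionFree.closedAdj_of_hasPathsC7 (hG : G.ObstructionFree)
    (hv : G.Realizes 7 rowC7 v) {y w z : V} (hy : G.typeCode 7 v y = 0) (hyw : G.ClosedAdj y w)
    (h : HasPathsC7 (G.typeCode 7 v w) (G.typeCode 7 v z)) : G.ClosedAdj w z := by
  by_contra hwz
  obtain ⟨⟨i, hi, hwi, hzi⟩, a, ha, b, hb, c, hc, hwa, hzb, hzc, hza, hwb, hwc, hab, hac, hbc⟩ := h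
  have h0 {i : ℕ} (hi : i < 7) : G.closedAdjBool y (v i) = false := by
    rw [← testBit_typeCode y hi, hy, Nat.zero_testBit]
  rw [testBit_typeCode _ (by assumption)] at hwi hzi hwa hzb hzc hza hwb hwc
  rw [← hv _ (by assumption) _ (by assumption)] at hab hac hbc
  rw [← closedAdjBool_eq_true] at hyw
  rw [← closedAdjBool_eq_false] at hwz
  cases hyz : G.closedAdjBool y z
  · have := hG [y, w, v a, v b, z, v c]
    simp [isObstruction, closedAdjBool_comm (v c) y, closedAdjBool_comm (v b) z,
      closedAdjBool_comm (v a) z, h0 ha, h0 hb, h0 hc, hyw, hwz, hyz, hwa, hzb, hzc, hza, hwb, hwc,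
      hab, hac, hbc] at this
  · have := hG [y, w, v i, z]
    simp [isObstruction, closedAdjBool_comm _ y, h0 hi, hyw, hwi, hzi, hyz, hwz,
      closedAdjBool_comm (v i) z] at this

lemma ObstructionFree.constructibleWithLabels_of_C7 [Finite V] (hG : G.ObstructionFree)
    (hv : G.Realizes 7 rowC7 v) (hsimp : ∀ x, ¬ IsSimplicialVertex G x) :
    ConstructibleWithLabels G 12 := by
  have : Nonempty V := ⟨v 0⟩
  have htype (x : V) : G.typeCode 7 v x = 0 ∨ IsTypeC7 (G.typeCode 7 v x) :=
    isTypeC7_of_compatible _ (typeCode_lt x)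
      (hG.compatible' hv certC7 rfl rfl (closedAdjBool_eq_true.2 (.refl x)))
  have hne := typeCode_ne_of_forall_not_isSimplicialVertex (v := v) hG hsimp 0
    (fun m => m ∈ typesC7 ∧ ∀ i : Fin 7, m ≠ rowC7 i)
    (fun x y z => typeCode_zero_no_induced_path hG hv (a := 0) (b := 1) (c := 2) (by decide)
      (by decide) (by decide) (by decide) (by decide) (by decide))
    (fun x w hx hw hxw => by
      have hw' := ((htype w).resolve_left hw).mem_typesC7
      exact ⟨hw', compatible_zero_C7 _ hw'
        (hG.compatible' hv certC7 hx rfl (closedAdjBool_eq_true.2 hxw))⟩)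
    (fun x y w z hx hy hyw hxz hw hz => by
      by_contra hwz
      have hwz' := closedAdjBool_eq_false.2 hwz
      rcases hasPathsC7_or_hasPathsC7 _ hw.1 _ hz.1 hw.2 hz.2 (hG.compatible' hv certC7 rfl rfl hwz')
        (hG.compatible' hv certC7 rfl rfl ((closedAdjBool_comm _ _).trans hwz')) with h | h
      · exact hwz (hG.closedAdj_of_hasPathsC7 hv hy hyw h)
      · exact hwz (hG.closedAdj_of_hasPathsC7 hv hx hxz h).symm)
  replace htype (x : V) := (htype x).resolve_left (hne x)
  classical
  let B : Finset (Fin 7) := Finset.univ.filter fun i => ∃ x, G.typeCode 7 v x = splitC7 i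
  let D : Finset (Fin 7) := Finset.univ.filter fun i => ∃ x, G.typeCode 7 v x = longC7 i
  have hB : B.card ≤ 2 := by
    -- Cyclically consecutive elements of `S` are at least 3 apart, which leaves room for two.
    have : ∀ S : Finset (Fin 7), (∀ i ∈ S, ∀ j ∈ [i + 1, i + 2], j ∉ S) → S.card ≤ 2 := by
      decide +kernel
    refine this B fun i hi j hj hjB => ?_
    obtain ⟨-, x, hx⟩ := Finset.mem_filter.1 hi
    obtain ⟨-, y, hy⟩ := Finset.mem_filter.1 hjB
    have h := not_compatible_splitC7 i _ j hj (hG.compatible' hv certC7 hx hy rfl)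
    rw [hG.compatible' hv certC7 hy hx (closedAdjBool_comm y x)] at h
    cases h
  have hD : D.card ≤ 3 := by
    -- Steps of 2 run through the residues modulo 7 in a 7-cycle, whose stable sets have at most
    -- three elements.
    have : ∀ S : Finset (Fin 7), (∀ i ∈ S, i + 2 ∉ S) → S.card ≤ 3 := by decide +kernel
    refine this D fun i hi hjD => ?_
    obtain ⟨-, x, hx⟩ := Finset.mem_filter.1 hi
    obtain ⟨-, y, hy⟩ := Finset.mem_filter.1 hjD
    have h := not_compatible_longC7 i _ (hG.compatible' hv certC7 hx hy rfl)
    rw [hG.compatible' hv certC7 hy hx (closedAdjBool_comm y x)] at h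
    cases h
  refine constructibleWithLabels_of_typeCode (by decide) (G.typeCode 7 v)
    (Finset.univ.image (fun i : Fin 7 => rowC7 i) ∪ (B.image splitC7 ∪ D.image longC7))
    ?_ 127 ?_ ?_ ?_
  · calc _ ≤ 7 + (2 + 3) := (Finset.card_union_le _ _).trans (add_le_add Finset.card_image_le
          ((Finset.card_union_le _ _).trans
            (add_le_add (Finset.card_image_le.trans hB) (Finset.card_image_le.trans hD))))
      _ = 12 := rfl
  · intro x hx
    simp only [Finset.mem_union, Finset.mem_image, Finset.mem_univ, true_and, Finset.mem_filter, B,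
      D]
    rcases htype x with ⟨i, hi⟩ | ⟨i, hi⟩ | ⟨i, hi⟩ | hi
    · exact .inl ⟨i, hi.symm⟩
    · exact .inr (.inl ⟨i, ⟨x, hi⟩, hi.symm⟩)
    · exact .inr (.inr ⟨i, ⟨x, hi⟩, hi.symm⟩)
    · exact absurd hi hx
  · intro u x hu
    by_contra h
    have h' := compatible_full_C7 _ (htype x).mem_typesC7
    rw [hG.compatible' hv certC7 rfl hu (closedAdjBool_eq_false.2 (mt ClosedAdj.symm h))] at h'
    cases h'
  · exact closedAdj_congr_of_typeCode hG hv certC7 typesC7 (fun x => (htype x).mem_typesC7)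
      not_compatible_both_C7

end SimpleGraph

namespace SimpleGraph

variable {V : Type*} {G : SimpleGraph V} {v : ℕ → V}

/-! ### Graphs with an induced `T₀` -/

/-- Codes of the closed neighbourhoods in `T₀`, with the vertices in the order `a₀`, `a₁`, `b₀`,
`b₁`, `b₂`, `b₃`, `c₁`, `c₂`, `c₃`. -/
def rowT0 (i : ℕ) : ℕ := [55, 59, 69, 74, 147, 291, 460, 464, 480].getD i 0

/-- Potential obstructions in an extension of `T₀` by two vertices. -/
def certT0 : List (List ℕ) :=
  [[0, 1, 9, 2], [0, 1, 3, 9], [0, 2, 6, 9], [0, 4, 9, 5], [1, 4, 7, 9], [2, 6, 8, 9],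
    [1, 5, 8, 9], [4, 7, 6, 9], [5, 8, 7, 9], [0, 4, 7, 6, 9, 5], [3, 1, 5, 2, 9, 7], [3, 6, 7, 9],
    [0, 9, 3, 10], [5, 0, 9, 3, 6, 7], [1, 0, 2, 7, 8, 9], [1, 3, 6, 9], [2, 6, 3, 9],
    [4, 1, 9, 2, 6, 8], [4, 7, 10, 9], [6, 8, 10, 9], [1, 0, 2, 8, 7, 9], [1, 0, 2, 9, 7, 10],
    [0, 1, 3, 6, 7, 9], [1, 5, 9, 2, 6, 7], [3, 1, 4, 2, 9, 8], [0, 9, 6, 10], [1, 9, 2, 10],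
    [1, 3, 9, 4], [1, 9, 6, 10], [2, 9, 3, 10], [0, 4, 9, 3, 6, 8], [4, 1, 5, 2, 6, 9],
    [0, 4, 10, 9], [0, 5, 10, 9], [0, 9, 7, 10], [0, 9, 8, 10], [3, 6, 8, 9], [6, 7, 10, 9],
    [7, 8, 10, 9], [1, 0, 2, 7, 10, 9], [4, 0, 5, 3, 10, 9], [1, 3, 6, 2, 9, 5],
    [2, 6, 3, 4, 9, 5], [2, 9, 3, 4, 7, 8], [0, 2, 10, 9], [1, 3, 9, 5], [2, 6, 10, 9],
    [3, 6, 10, 9], [4, 9, 6, 10], [5, 9, 6, 10], [0, 10, 9, 3, 6, 7], [5, 1, 9, 2, 6, 7],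
    [1, 10, 9, 2, 6, 8], [0, 1, 10, 9], [1, 4, 9, 5], [1, 4, 10, 9], [1, 5, 10, 9], [2, 6, 7, 9],
    [4, 9, 5, 10], [5, 8, 6, 9], [0, 1, 9, 8, 6, 2], [2, 0, 5, 3, 9, 7], [0, 2, 6, 8, 9, 4],
    [0, 2, 9, 8, 7, 4], [0, 2, 9, 8, 10, 4], [0, 2, 6, 7, 9, 5], [0, 2, 9, 7, 8, 5],
    [0, 2, 9, 7, 10, 5], [0, 2, 6, 7, 10, 9], [0, 2, 6, 8, 10, 9], [4, 0, 5, 6, 3, 9],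
    [4, 0, 5, 3, 6, 9], [4, 0, 5, 9, 3, 10], [4, 0, 9, 3, 6, 8], [4, 0, 9, 3, 6, 10],
    [4, 0, 9, 3, 10, 8], [5, 0, 9, 3, 6, 10], [0, 9, 3, 6, 7, 10], [9, 0, 10, 3, 6, 7],
    [0, 9, 3, 6, 8, 10], [9, 0, 10, 3, 6, 8], [3, 1, 4, 2, 10, 9], [4, 1, 5, 6, 2, 9],
    [2, 9, 3, 4, 7, 10], [2, 9, 3, 5, 8, 10], [2, 6, 10, 4, 9, 5], [3, 6, 10, 4, 9, 5]]

/-- The codes of the types of vertices over an induced `T₀`, except for the empty type and for the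
type `{c₂, c₃}`. -/
def typesT0 : List ℕ := [55, 59, 69, 74, 147, 223, 291, 367, 460, 464, 480, 511]

lemma mem_typesT0_of_compatible : ∀ m < 2 ^ 9, compatible 9 rowT0 certT0 m m true = true →
    m = 0 ∨ m = 384 ∨ m ∈ typesT0 := by
  decide +kernel

lemma not_compatible_both_T0 : ∀ m₁ ∈ typesT0, ∀ m₂ ∈ typesT0, m₁ ≤ m₂ →
    compatible 9 rowT0 certT0 m₁ m₂ true = true →
    compatible 9 rowT0 certT0 m₁ m₂ false = false := by
  decide +kernel

/-- The codes 223 and 367 omit exactly `{b₃, c₃}` and `{b₂, c₂}`, and 511 is the full type. By the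
next lemma, vertices of these types are pairwise closed-adjacent, so the empty type would contain a
simplicial vertex. -/
lemma compatible_zero_T0 : ∀ m ∈ 384 :: typesT0, compatible 9 rowT0 certT0 0 m true = true →
    m ∈ [223, 367, 511] := by
  decide +kernel

lemma not_compatible_false_of_zero_T0 : ∀ m₁ ∈ [223, 367, 511], ∀ m₂ ∈ [223, 367, 511],
    compatible 9 rowT0 certT0 m₁ m₂ false = true →
    compatible 9 rowT0 certT0 m₂ m₁ false = false := by
  decide +kernel

/-- The code 384 is the type `{c₂, c₃}`; 464 and 480 are the types of `c₂` and `c₃`. As vertices of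
types 464, 480 and 511 form a clique and those of type 384 do too, the latter type would contain a
simplicial vertex. -/
lemma compatible_pair_T0 : ∀ m ∈ typesT0, compatible 9 rowT0 certT0 384 m true = true →
    compatible 9 rowT0 certT0 m 384 true = true → m ∈ [464, 480, 511] := by
  decide +kernel

lemma not_compatible_pair_T0 : compatible 9 rowT0 certT0 384 384 false = false := by
  decide +kernel

lemma not_compatible_false_of_pair_T0 : ∀ m₁ ∈ [464, 480, 511], ∀ m₂ ∈ [464, 480, 511],
    compatible 9 rowT0 certT0 m₁ m₂ false = true →
    compatible 9 rowT0 certT0 m₂ m₁ false = false := by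
  decide +kernel

lemma compatible_full_T0 : ∀ m ∈ typesT0, compatible 9 rowT0 certT0 m 511 false = false := by
  decide +kernel

lemma ObstructionFree.constructibleWithLabels_of_T0 [Finite V] (hG : G.ObstructionFree)
    (hv : G.Realizes 9 rowT0 v) (hsimp : ∀ x, ¬ IsSimplicialVertex G x) :
    ConstructibleWithLabels G 12 := by
  have : Nonempty V := ⟨v 0⟩
  have htype (x : V) : G.typeCode 9 v x = 0 ∨ G.typeCode 9 v x = 384 ∨
      G.typeCode 9 v x ∈ typesT0 :=
    mem_typesT0_of_compatible _ (typeCode_lt x)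
      (hG.compatible' hv certT0 rfl rfl (closedAdjBool_eq_true.2 (.refl x)))
  have hclique (A : List ℕ) (hA : ∀ m₁ ∈ A, ∀ m₂ ∈ A,
      SimpleGraph.compatible 9 rowT0 certT0 m₁ m₂ false = true →
      SimpleGraph.compatible 9 rowT0 certT0 m₂ m₁ false = false) (w z : V) (hw : G.typeCode 9 v w ∈ A)
      (hz : G.typeCode 9 v z ∈ A) : G.ClosedAdj w z := by
    by_contra hwz
    rw [← closedAdjBool_eq_false] at hwz
    have h := hA _ hw _ hz (hG.compatible' hv certT0 rfl rfl hwz)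
    rw [hG.compatible' hv certT0 rfl rfl ((closedAdjBool_comm _ _).trans hwz)] at h
    cases h
  have hne := typeCode_ne_of_forall_not_isSimplicialVertex (v := v) hG hsimp 0
    (· ∈ [223, 367, 511])
    -- The induced path `b₀ a₀ b₂` of `T₀`.
    (fun x y z => typeCode_zero_no_induced_path hG hv (a := 2) (b := 0) (c := 4) (by decide)
      (by decide) (by decide) (by decide) (by decide) (by decide))
    (fun x w hx hw hxw => compatible_zero_T0 _ (List.mem_cons.2 ((htype w).resolve_left hw))
      (hG.compatible' hv certT0 hx rfl (closedAdjBool_eq_true.2 hxw)))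
    (fun _ _ w z _ _ _ _ => hclique _ not_compatible_false_of_zero_T0 w z)
  replace htype (x : V) := (htype x).resolve_left (hne x)
  have hne' := typeCode_ne_of_forall_not_isSimplicialVertex (v := v) hG hsimp 384
    (· ∈ [464, 480, 511])
    (fun x y z hx _ hz _ _ => by
      by_contra hxz
      have h := hG.compatible' hv certT0 hx hz (closedAdjBool_eq_false.2 hxz)
      rw [not_compatible_pair_T0] at h
      cases h)
    (fun x w hx hw hxw => compatible_pair_T0 _ ((htype w).resolve_left hw)
      (hG.compatible' hv certT0 hx rfl (closedAdjBool_eq_true.2 hxw))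
      (hG.compatible' hv certT0 rfl hx (closedAdjBool_eq_true.2 hxw.symm)))
    (fun _ _ w z _ _ _ _ => hclique _ not_compatible_false_of_pair_T0 w z)
  replace htype (x : V) := (htype x).resolve_left (hne' x)
  -- The list has twelve entries, so the universal type 511 need not be removed from it.
  refine constructibleWithLabels_of_typeCode (by decide) (G.typeCode 9 v) typesT0.toFinset
    (by decide) 511 (fun x _ => List.mem_toFinset.2 (htype x)) ?_ ?_
  · intro u x hu
    by_contra h
    have h' := compatible_full_T0 _ (htype x)
    rw [hG.compatible' hv certT0 rfl hu (closedAdjBool_eq_false.2 (mt ClosedAdj.symm h))] at h'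
    cases h'
  · exact closedAdj_congr_of_typeCode hG hv certT0 typesT0 htype not_compatible_both_T0

/-! ### From induced copies to binary codes -/

lemma closedAdj_iff_of_embedding {ι : Type*} {H : SimpleGraph ι} (f : H ↪g G) (i j : ι) :
    G.ClosedAdj (f i) (f j) ↔ H.ClosedAdj i j := by
  simp [ClosedAdj, f.injective.eq_iff]

lemma exists_realizes_of_C7 (h : cycleGraph 7 ⊴ G) : ∃ v : ℕ → V, G.Realizes 7 rowC7 v := by
  obtain ⟨f⟩ := h
  refine ⟨fun i => f (Fin.ofNat 7 i), fun i hi j hj => ?_⟩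
  rw [Bool.eq_iff_iff, closedAdjBool_eq_true, closedAdj_iff_of_embedding]
  have key : ∀ i j : Fin 7, (i = j ∨ (cycleGraph 7).Adj i j) ↔ (rowC7 i).testBit j = true := by
    decide
  simpa [ClosedAdj, Nat.mod_eq_of_lt, hi, hj] using key (Fin.ofNat 7 i) (Fin.ofNat 7 j)

set_option maxHeartbeats 1000000 in
lemma exists_realizes_of_T0 (h : graphT0 ⊴ G) : ∃ v : ℕ → V, G.Realizes 9 rowT0 v := by
  obtain ⟨f⟩ := h
  let t : ℕ → T0Vertex := fun i => [T0Vertex.a0, .a1, .b0, .b1, .b2, .b3, .c1, .c2, .c3].getD i .a0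
  refine ⟨fun i => f (t i), fun i hi j hj => ?_⟩
  rw [Bool.eq_iff_iff, closedAdjBool_eq_true, closedAdj_iff_of_embedding]
  simp only [ClosedAdj, graphT0, fromEdgeSet_adj, Set.mem_insert_iff, Set.mem_singleton_iff,
    Sym2.eq_iff]
  interval_cases i <;> interval_cases j <;> simp [t, rowT0] <;> decide

end SimpleGraph

theorem mainTheorem1 {V : Type*} [Finite V] (G : SimpleGraph V)
    (h2P3 : ¬ twoP3 ⊴ G)
    (hC4 : ¬ SimpleGraph.cycleGraph 4 ⊴ G)
    (hC6 : ¬ SimpleGraph.cycleGraph 6 ⊴ G)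
    (hC7T0 : SimpleGraph.cycleGraph 7 ⊴ G ∨ graphT0 ⊴ G)
    (hsimp : ∀ v : V, ¬ IsSimplicialVertex G v) :
    cliqueWidth G ≤ 12 := by
  have hG := SimpleGraph.obstructionFree_of_not_isIndContained h2P3 hC4 hC6
  refine cliqueWidth_le ?_
  rcases hC7T0 with h | h
  · obtain ⟨v, hv⟩ := SimpleGraph.exists_realizes_of_C7 h
    exact hG.constructibleWithLabels_of_C7 hv hsimp
  · obtain ⟨v, hv⟩ := SimpleGraph.exists_realizes_of_T0 h
    exact hG.constructibleWithLabels_of_T0 hv hsimp
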